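/- Let $G$ and $N$ be two finite groups of the same order. Let $\mathrm{Perm}(N)$ be the symmetric group of the set $N$, let $\rho : N \to \mathrm{Perm}(N)$, $\rho(\eta) = (x \mapsto x\eta^{-1})$, be the right regular representation, and let $\mathrm{Hol}(N) = \rho(N) \rtimes \mathrm{Aut}(N) \le \mathrm{Perm}(N)$ be the holomorph of $N$. Call a subgroup $\mathcal{G}$ of $\mathrm{Perm}(N)$ regular if the map $\mathcal{G} \to N$, $\sigma \mapsto \sigma(1_N)$, is bijective, and let \[ \mathcal{E}'(G,N) = \{\text{regular subgroups of } \mathrm{Hol}(N) \text{ isomorphic to } G\}. \] Let $\mathrm{Fit}(N)$ denote the Fitting subgroup of $N$, that is, its unique largest normal nilpotent subgroup. Suppose that $\mathcal{E}'(G,N)$ is non-empty. Then \[ \{|M| : M \text{ is a characteristic subgroup of } N\} \subseteq \{|H| : H \text{ is a subgroup of } G\}. \] Moreover, $G$ has a solvable subgroup of order $|\mathrm{Fit}(N)|$. -/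

import Mathlib

/-- The right regular representation `ρ : N → Perm(N)`, `ρ(η) = (x ↦ x η⁻¹)`. -/
def rightRegular (N : Type*) [Group N] : N →* Equiv.Perm N where
  toFun η := Equiv.mulRight η⁻¹
  map_one' := by ext x; simp
  map_mul' a b := by ext x; simp [mul_assoc]

/-- The holomorph `Hol(N) = ρ(N) ⋊ Aut(N)`, as the subgroup of `Perm(N)` generated by its
subgroups `ρ(N)` and `Aut(N)`. -/
def holomorph (N : Type*) [Group N] : Subgroup (Equiv.Perm N) :=
  (rightRegular N).range ⊔ (MulAut.toPerm N).range

/-- The holomorph is the internal product `ρ(N) Aut(N)`. -/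
theorem mem_holomorph {N : Type*} [Group N] {σ : Equiv.Perm N} :
    σ ∈ holomorph N ↔ ∃ (η : N) (φ : MulAut N), rightRegular N η * MulAut.toPerm N φ = σ := by
  constructor
  · intro h
    refine Subgroup.closure_induction
      (p := fun τ _ => ∃ (η : N) (φ : MulAut N), rightRegular N η * MulAut.toPerm N φ = τ)
      ?_ ?_ ?_ ?_ (show σ ∈ Subgroup.closure
        (((rightRegular N).range : Set (Equiv.Perm N)) ∪ (MulAut.toPerm N).range) by
        rw [← Subgroup.sup_eq_closure]; exact h)
    · rintro x (⟨η, rfl⟩ | ⟨φ, rfl⟩)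
      · exact ⟨η, 1, by simp⟩
      · exact ⟨1, φ, by simp⟩
    · exact ⟨1, 1, by simp⟩
    · rintro _ _ _ _ ⟨η, φ, rfl⟩ ⟨η', φ', rfl⟩
      refine ⟨η * φ η', φ * φ', ?_⟩
      ext x
      change φ (φ' x) * (η * φ η')⁻¹ = φ (φ' x * η'⁻¹) * η⁻¹
      simp [mul_assoc]
    · rintro _ _ ⟨η, φ, rfl⟩
      refine ⟨φ⁻¹ η⁻¹, φ⁻¹, ?_⟩
      rw [eq_inv_iff_mul_eq_one]
      ext x
      change φ⁻¹ (φ x * η⁻¹) * (φ⁻¹ η⁻¹)⁻¹ = x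
      simp
  · rintro ⟨η, φ, rfl⟩
    exact mul_mem (Subgroup.mem_sup_left ⟨η, rfl⟩) (Subgroup.mem_sup_right ⟨φ, rfl⟩)

/-- A subgroup `𝒢` of `Perm(N)` is regular if `𝒢 → N`, `σ ↦ σ(1)`, is bijective. -/
def IsRegularSubgroup {N : Type*} [Group N] (𝒢 : Subgroup (Equiv.Perm N)) : Prop :=
  Function.Bijective (fun σ : 𝒢 => (σ : Equiv.Perm N) 1)

/-- `E'(G,N)`: the set of regular subgroups of `Hol(N)` isomorphic to `G`. -/
def regularSubgroupsOfHol (G N : Type*) [Group G] [Group N] : Set (Subgroup (Equiv.Perm N)) :=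
  {𝒢 | 𝒢 ≤ holomorph N ∧ IsRegularSubgroup 𝒢 ∧ Nonempty (𝒢 ≃* G)}

/-- The Fitting subgroup: the join of all normal nilpotent subgroups. In a finite group this is
itself nilpotent, and so it is the unique largest normal nilpotent subgroup. -/
def fittingSubgroup (N : Type*) [Group N] : Subgroup N :=
  sSup {K : Subgroup N | K.Normal ∧ Group.IsNilpotent K}

/-! Let `𝒢` be a regular subgroup of the holomorph isomorphic to `G`, and `M` a characteristic
subgroup of `N`. An element `x ↦ φ(x)η⁻¹` of `𝒢` that sends `1` into `M` has `η ∈ M`, hence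
preserves `M`. So these elements form a subgroup of `𝒢`, and by regularity its order is `|M|`; it is
carried to `G`.

If `M` is nilpotent, this subgroup `S` is solvable, by induction on `|M|`. For each prime `p`
dividing `|M|`, the `p`-complement of `M` is again characteristic in `N` and nilpotent, so it yields
a solvable subgroup of `S` of `p`-power index. With three primes available, Wielandt's theorem on
solvable subgroups of pairwise coprime indices applies; otherwise Burnside's `p^a q^b` theorem does.
Taking `M = Fit(N)`, which is characteristic and (Fitting) nilpotent, finishes.

Burnside's theorem is proved with characters, Wielandt's by finding a solvable normal subgroup
inside one of the three. -/

/-! ### Averages of roots of unity -/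

/-- An average of complex roots of unity that is an algebraic integer is either zero or an average
of equal terms. -/
theorem Complex.sum_eq_zero_or_all_eq_of_isIntegral_avg {m : ℕ} (hm : 0 < m) (s : Multiset ℂ)
    (hs : ∀ x ∈ s, x ^ m = 1) (hint : IsIntegral ℤ (s.sum / s.card)) :
    s.sum = 0 ∨ ∃ z : ℂ, ∀ x ∈ s, x = z := by
  by_cases h0 : s.sum = 0
  · exact Or.inl h0
  right
  have hcard : (s.card : ℂ) ≠ 0 := by
    rintro h
    rw [Nat.cast_eq_zero, Multiset.card_eq_zero] at h
    simp [h] at h0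
  have hcardR : (0 : ℝ) < s.card := by
    have : s.card ≠ 0 := by exact_mod_cast hcard
    positivity
  let S : Set ℂ := {x | x ∈ s}
  have hfin : S.Finite := by
    classical
    exact (s.toFinset.finite_toSet).subset fun x hx => by simpa [S] using hx
  have : Finite S := hfin
  let K := IntermediateField.adjoin ℚ S
  have hFD : FiniteDimensional ℚ K := IntermediateField.finiteDimensional_adjoin fun x hx =>
    IsIntegral.of_pow hm (by rw [hs x hx]; exact isIntegral_one)
  have hNF : NumberField K := { to_charZero := inferInstance, to_finiteDimensional := hFD }
  let t : Multiset K := s.pmap (fun x hx => ⟨x, hx⟩)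
    fun x hx => IntermediateField.subset_adjoin ℚ S hx
  have hts : t.map (algebraMap K ℂ) = s := by
    simp only [t, Multiset.map_pmap]
    exact (Multiset.pmap_eq_map _ _ _ _).trans (Multiset.map_id' s)
  have htc : t.card = s.card := Multiset.card_pmap _ _ _
  have htp : ∀ y ∈ t, y ^ m = 1 := by
    intro y hy
    have := hs (algebraMap K ℂ y) (by rw [← hts]; exact Multiset.mem_map_of_mem _ hy)
    rw [← map_pow] at this
    exact (algebraMap K ℂ).injective (by rw [this, map_one])
  have hval : algebraMap K ℂ (t.sum / t.card) = s.sum / s.card := by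
    rw [map_div₀, map_multiset_sum, hts, map_natCast, htc]
  have hne : t.sum / t.card ≠ 0 := by
    intro h
    rw [h, map_zero, eq_comm, div_eq_zero_iff] at hval
    tauto
  have hintK : IsIntegral ℤ (t.sum / t.card) :=
    (isIntegral_algebraMap_iff (algebraMap K ℂ).injective).1 (hval ▸ hint)
  -- Kronecker: each conjugate of the average is again an average of roots of unity, so has norm at
  -- most `1`; a nonzero algebraic integer with this property is a root of unity.
  obtain ⟨k, hk, hpow⟩ := NumberField.Embeddings.pow_eq_one_of_norm_le_one K ℂ hne hintK (by
    intro φ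
    rw [map_div₀, map_multiset_sum, map_natCast, norm_div, htc, Complex.norm_natCast,
      div_le_one hcardR]
    refine (norm_multiset_sum_le _).trans ?_
    rw [Multiset.map_map]
    refine (Multiset.sum_le_card_nsmul _ 1 ?_).trans ?_
    · intro r hr
      obtain ⟨y, hy, rfl⟩ := Multiset.mem_map.1 hr
      refine le_of_eq (norm_eq_one_of_pow_eq_one (n := m) ?_ hm.ne')
      rw [← map_pow, htp y hy, map_one]
    · simp [htc])
  set w : ℂ := s.sum / s.card with hw
  have hwn : ‖w‖ = 1 := by
    refine norm_eq_one_of_pow_eq_one (n := k) ?_ hk.ne'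
    rw [← hval, ← map_pow, hpow, map_one]
  have hxn : ∀ x ∈ s, ‖x‖ = 1 := fun x hx => norm_eq_one_of_pow_eq_one (hs x hx) hm.ne'
  -- Equality case of the triangle inequality: `L x = Re(w̄x)` is at most `1` on each term and
  -- averages to `1`. Then `|x - w|² = 2 - 2 L x = 0`.
  let L : ℂ →+ ℝ := Complex.reAddGroupHom.comp (AddMonoidHom.mulLeft ((starRingEnd ℂ) w))
  have hL : ∀ x ∈ s, L x ≤ 1 := fun x hx => by
    refine (Complex.re_le_norm _).trans ?_
    simp [hwn, hxn x hx]
  have hLsum : (s.map L).sum = s.card := by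
    rw [← map_multiset_sum]
    have : s.sum = w * s.card := by rw [hw]; field_simp
    rw [this]
    change ((starRingEnd ℂ) w * (w * s.card)).re = _
    rw [← mul_assoc, mul_comm ((starRingEnd ℂ) w), Complex.mul_conj, Complex.normSq_eq_norm_sq, hwn]
    simp
  have hL1 : ∀ x ∈ s, L x = 1 := by
    intro x hx
    by_contra hlt
    have hlt' := lt_of_le_of_ne (hL x hx) hlt
    have := Multiset.sum_lt_sum (s := s) (f := L) (g := fun _ => (1 : ℝ)) hL ⟨x, hx, hlt'⟩
    rw [hLsum] at this
    simp at this
  refine ⟨w, fun x hx => ?_⟩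
  have h1 : ((starRingEnd ℂ) w * x).re = 1 := hL1 x hx
  have h2 := hxn x hx
  rw [← sq_eq_sq₀ (norm_nonneg _) zero_le_one, ← Complex.normSq_eq_norm_sq,
    Complex.normSq_apply] at h2 hwn
  simp only [Complex.mul_re, Complex.conj_re, Complex.conj_im] at h1
  apply Complex.ext <;> nlinarith [sq_nonneg (x.re - w.re), sq_nonneg (x.im - w.im)]

/-! ### Complex matrices of finite order -/

namespace Matrix

variable {n : Type*} [Fintype n] [DecidableEq n]

theorem pow_eq_one_of_mem_roots_charpoly {M : Matrix n n ℂ} {m : ℕ} (hM : M ^ m = 1)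
    {x : ℂ} (hx : x ∈ M.charpoly.roots) : x ^ m = 1 := by
  have hsp : x ∈ spectrum ℂ M := by
    rw [Matrix.mem_spectrum_iff_isRoot_charpoly]
    exact Polynomial.isRoot_of_mem_roots hx
  have := spectrum.pow_mem_pow M m hsp
  rw [hM] at this
  by_contra hne
  rw [spectrum.mem_iff] at this
  apply this
  rw [← map_one (algebraMap ℂ (Matrix n n ℂ)), ← map_sub]
  exact (isUnit_iff_ne_zero.2 (sub_ne_zero.2 hne)).map _

theorem card_roots_charpoly_complex (M : Matrix n n ℂ) :
    M.charpoly.roots.card = Fintype.card n := by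
  rw [IsAlgClosed.card_roots_eq_natDegree, M.charpoly_natDegree_eq_dim]

open Polynomial in
/-- A complex matrix of finite order with a single eigenvalue is scalar. -/
theorem eq_scalar_of_pow_eq_one_of_roots_charpoly_eq {M : Matrix n n ℂ} {m : ℕ} (hm : 0 < m)
    (hM : M ^ m = 1) {z : ℂ} (hz : ∀ x ∈ M.charpoly.roots, x = z) :
    M = algebraMap ℂ (Matrix n n ℂ) z := by
  cases isEmpty_or_nonempty n
  · exact Subsingleton.elim _ _
  have hcp : M.charpoly = (X - C z) ^ Fintype.card n := by
    have h := (IsAlgClosed.splits M.charpoly).eq_prod_roots_of_monic M.charpoly_monic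
    rw [Multiset.eq_replicate_of_mem hz, card_roots_charpoly_complex] at h
    rw [h]
    simp
  have hzm : z ^ m = 1 := by
    refine pow_eq_one_of_mem_roots_charpoly hM (x := z) ?_
    rw [Multiset.eq_replicate_of_mem hz, card_roots_charpoly_complex]
    exact Multiset.mem_replicate.2 ⟨Fintype.card_ne_zero, rfl⟩
  obtain ⟨q, hq⟩ : (X - C z) ∣ (X ^ m - 1 : ℂ[X]) := by
    rw [dvd_iff_isRoot]; simp [hzm]
  have hsep : (X ^ m - 1 : ℂ[X]).Separable :=
    Polynomial.separable_X_pow_sub_C 1 (by exact_mod_cast hm.ne') one_ne_zero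
  rw [hq] at hsep
  -- Both `(X - z)^n` and `(X - z)q` annihilate `M`. Separability makes `q` prime to `X - z`, so `X
  -- - z` is a combination of the two.
  have hcop : IsCoprime ((X - C z) ^ Fintype.card n) q := hsep.isCoprime.pow_left
  obtain ⟨u, v, huv⟩ := hcop
  have h1 : aeval M ((X - C z) ^ Fintype.card n) = 0 := by
    rw [← hcp]; exact M.aeval_self_charpoly
  have h2 : aeval M ((X - C z) * q) = 0 := by
    rw [← hq]; simp [hM]
  have h3 : aeval M ((X - C z) * (u * (X - C z) ^ Fintype.card n + v * q)) = 0 := by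
    rw [show (X - C z) * (u * (X - C z) ^ Fintype.card n + v * q) =
      ((X - C z) * u) * (X - C z) ^ Fintype.card n + v * ((X - C z) * q) by ring,
      map_add, map_mul, h1, map_mul (aeval M) v, h2]
    simp
  rw [huv, mul_one] at h3
  simpa [sub_eq_zero] using h3

theorem isIntegral_trace_of_pow_eq_one {M : Matrix n n ℂ} {m : ℕ} (hm : 0 < m)
    (hM : M ^ m = 1) : IsIntegral ℤ M.trace := by
  rw [Matrix.trace_eq_sum_roots_charpoly]
  refine Multiset.sum_induction (IsIntegral ℤ) _ (fun _ _ => IsIntegral.add) isIntegral_zero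
    fun x hx => ?_
  exact IsIntegral.of_pow hm (by rw [pow_eq_one_of_mem_roots_charpoly hM hx]; exact isIntegral_one)

theorem trace_eq_zero_or_eq_scalar_of_isIntegral {M : Matrix n n ℂ} {m : ℕ} (hm : 0 < m)
    (hM : M ^ m = 1) (hint : IsIntegral ℤ (M.trace / Fintype.card n)) :
    M.trace = 0 ∨ ∃ z, M = algebraMap ℂ (Matrix n n ℂ) z := by
  rw [Matrix.trace_eq_sum_roots_charpoly, ← card_roots_charpoly_complex M] at hint
  rw [Matrix.trace_eq_sum_roots_charpoly]
  refine (Complex.sum_eq_zero_or_all_eq_of_isIntegral_avg hm _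
    (fun x => pow_eq_one_of_mem_roots_charpoly hM) hint).imp_right ?_
  rintro ⟨z, hz⟩
  exact ⟨z, eq_scalar_of_pow_eq_one_of_roots_charpoly_eq hm hM hz⟩

/-- The trace of left multiplication on a product of matrix algebras. -/
theorem trace_mulLeft_pi {ι K : Type*} [Fintype ι] [DecidableEq ι] [Field K] (d : ι → ℕ)
    (M : Π i, Matrix (Fin (d i)) (Fin (d i)) K) :
    LinearMap.trace K _ (LinearMap.mulLeft K M) = ∑ i, d i * (M i).trace := by
  rw [LinearMap.trace_eq_matrix_trace K
    (Pi.basis fun i => Matrix.stdBasis K (Fin (d i)) (Fin (d i)))]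
  simp only [Matrix.trace, Matrix.diag_apply, LinearMap.toMatrix_apply, Fintype.sum_sigma,
    Pi.basis_apply, Fintype.sum_prod_type, LinearMap.mulLeft_apply, Pi.basis_repr]
  refine Finset.sum_congr rfl fun i _ => ?_
  -- The coefficient of `E_ab` in `M E_ab` is `M_aa` for every `b`, which gives the factor `d i`.
  have key (a b : Fin (d i)) : (stdBasis K (Fin (d i)) (Fin (d i))).repr
      (M i * stdBasis K (Fin (d i)) (Fin (d i)) (a, b)) (a, b) = M i a a := by
    rw [Matrix.stdBasis_eq_single]
    simp [stdBasis]
  simp [key, Finset.mul_sum]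

end Matrix

/-! ### Irreducible representations, as those whose image spans the matrix algebra -/

namespace MonoidHom

section Irreducible

variable {G n : Type*} [Group G] [Fintype n] [DecidableEq n]

/-- If the image of a representation spans the whole matrix algebra, then a matrix commuting with
the image is scalar. -/
theorem exists_eq_scalar_of_commute {ρ : G →* Matrix n n ℂ}
    (hρ : Submodule.span ℂ (Set.range ρ) = ⊤) {M : Matrix n n ℂ} (hM : ∀ g, ρ g * M = M * ρ g) :
    ∃ z, M = algebraMap ℂ (Matrix n n ℂ) z := by
  have hcomm (X : Matrix n n ℂ) : X * M = M * X := by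
    have hX : X ∈ Submodule.span ℂ (Set.range ρ) := hρ ▸ Submodule.mem_top
    induction hX using Submodule.span_induction with
    | mem x hx => obtain ⟨g, rfl⟩ := hx; exact hM g
    | zero => simp
    | add x y _ _ hx hy => rw [add_mul, mul_add, hx, hy]
    | smul a x _ hx => rw [smul_mul_assoc, mul_smul_comm, hx]
  obtain ⟨z, hz⟩ := Matrix.mem_range_scalar_of_commute_single fun i j _ =>
    hcomm (Matrix.single i j 1)
  exact ⟨z, hz.symm.trans (by ext i j; simp [Matrix.algebraMap_matrix_apply, Matrix.diagonal_apply])⟩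

/-- The sum is the image of an element of `ℤ[G]`, a ring finite over `ℤ`. -/
theorem isIntegral_sum [Finite G] {A : Type*} [Ring A] (ρ : G →* A) (s : Finset G) :
    IsIntegral ℤ (∑ x ∈ s, ρ x) := by
  have : Module.Finite ℤ (MonoidAlgebra ℤ G) := Module.Finite.of_basis (MonoidAlgebra.basis G ℤ)
  have h := (IsIntegral.of_finite ℤ (∑ x ∈ s, MonoidAlgebra.of ℤ G x)).map
    (MonoidAlgebra.lift ℤ A G ρ)
  simpa using h

/-- For an irreducible complex representation of a finite group, `|C| χ(g) / χ(1)` is an algebraic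
integer, `C` being the conjugacy class of `g`. -/
theorem isIntegral_card_conj_mul_trace_div [Fintype G] [Nonempty n] {ρ : G →* Matrix n n ℂ}
    (hρ : Submodule.span ℂ (Set.range ρ) = ⊤) (g : G) :
    IsIntegral ℤ ((Nat.card (ConjClasses.mk g).carrier : ℂ) *
      ((ρ g).trace / Fintype.card n)) := by
  classical
  let s : Finset G := Finset.univ.filter fun x => x ∈ (ConjClasses.mk g).carrier
  have hs (x : G) : x ∈ s ↔ IsConj g x := by
    rw [isConj_comm]
    simp only [s, Finset.mem_filter, Finset.mem_univ, true_and, ConjClasses.mem_carrier_iff_mk_eq,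
      ConjClasses.mk_eq_mk_iff_isConj]
  have hcard : Nat.card (ConjClasses.mk g).carrier = s.card := by
    rw [Nat.card_eq_fintype_card, Fintype.card_subtype]
  -- The class sum is invariant under conjugation, hence acts as a scalar `z`; comparing traces
  -- gives `|C| χ(g) = χ(1) z`.
  obtain ⟨z, hz⟩ := exists_eq_scalar_of_commute hρ (M := ∑ x ∈ s, ρ x) (by
    intro h
    rw [Finset.mul_sum, Finset.sum_mul]
    refine Finset.sum_bij' (fun x _ => h * x * h⁻¹) (fun x _ => h⁻¹ * x * h) ?_ ?_ ?_ ?_ ?_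
    · intro x hx
      rw [hs] at hx ⊢
      exact hx.trans (isConj_iff.2 ⟨h, rfl⟩)
    · intro x hx
      rw [hs] at hx ⊢
      exact hx.trans (isConj_iff.2 ⟨h⁻¹, by simp⟩)
    · intro x _; group
    · intro x _; group
    · intro x _
      rw [← map_mul, ← map_mul]
      group)
  have hzint : IsIntegral ℤ z := by
    have h := isIntegral_sum ρ s
    rw [hz] at h
    exact (isIntegral_algebraMap_iff (FaithfulSMul.algebraMap_injective ℂ (Matrix n n ℂ))).1 h
  have htr : (s.card : ℂ) * (ρ g).trace = Fintype.card n * z := by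
    have h := congrArg Matrix.trace hz
    rw [Matrix.trace_sum, Finset.sum_congr rfl (g := fun _ => (ρ g).trace), Finset.sum_const,
      nsmul_eq_mul] at h
    · rw [h]
      simp [Matrix.trace, Matrix.algebraMap_matrix_apply]
    · intro x hx
      obtain ⟨c, rfl⟩ := isConj_iff.1 ((hs x).1 hx)
      rw [map_mul, Matrix.trace_mul_comm, ← map_mul]
      congr 2
      group
  have hn : (Fintype.card n : ℂ) ≠ 0 := by simp
  rw [hcard, ← mul_div_assoc, htr, mul_div_cancel_left₀ _ hn]
  exact hzint

/-- By Bézout, `χ(g)/χ(1)` is an integral combination of the algebraic integers `|C| χ(g)/χ(1)` and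
`χ(g)`. It is also the average of the eigenvalues of `ρ g`. -/
theorem trace_eq_zero_or_eq_scalar_of_coprime [Finite G] [Nonempty n] {ρ : G →* Matrix n n ℂ}
    (hρ : Submodule.span ℂ (Set.range ρ) = ⊤) (g : G)
    (hcop : (Nat.card (ConjClasses.mk g).carrier).Coprime (Fintype.card n)) :
    (ρ g).trace = 0 ∨ ∃ z, ρ g = algebraMap ℂ (Matrix n n ℂ) z := by
  have := Fintype.ofFinite G
  have hm : 0 < orderOf g := orderOf_pos g
  have hg : ρ g ^ orderOf g = 1 := by rw [← map_pow, pow_orderOf_eq_one, map_one]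
  refine Matrix.trace_eq_zero_or_eq_scalar_of_isIntegral hm hg ?_
  obtain ⟨u, v, huv⟩ := hcop.isCoprime
  have huv' : (u : ℂ) * (Nat.card (ConjClasses.mk g).carrier : ℂ) + v * (Fintype.card n : ℂ) = 1 := by
    exact_mod_cast huv
  have hn : (Fintype.card n : ℂ) ≠ 0 := by simp
  have key : (ρ g).trace / Fintype.card n =
      u * ((Nat.card (ConjClasses.mk g).carrier : ℂ) * ((ρ g).trace / Fintype.card n)) +
        v * (ρ g).trace := by
    calc (ρ g).trace / Fintype.card n = ((u : ℂ) * (Nat.card (ConjClasses.mk g).carrier : ℂ) +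
          v * (Fintype.card n : ℂ)) * ((ρ g).trace / Fintype.card n) := by rw [huv', one_mul]
      _ = _ := by field_simp
  rw [key]
  exact ((isIntegral_algebraMap (x := u)).mul (isIntegral_card_conj_mul_trace_div hρ g)).add
    ((isIntegral_algebraMap (x := v)).mul (Matrix.isIntegral_trace_of_pow_eq_one hm hg))

/-- A representation with a nonzero fixed vector whose image spans the matrix algebra is trivial. -/
theorem eq_one_of_mul_eq_self {ρ : G →* Matrix n n ℂ}
    (hρ : Submodule.span ℂ (Set.range ρ) = ⊤) {M : Matrix n n ℂ} (hM0 : M ≠ 0)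
    (hM : ∀ g, ρ g * M = M) (g : G) : ρ g = 1 := by
  have hscal (X : Matrix n n ℂ) : ∃ c : ℂ, X * M = c • M := by
    have hX : X ∈ Submodule.span ℂ (Set.range ρ) := hρ ▸ Submodule.mem_top
    induction hX using Submodule.span_induction with
    | mem x hx => obtain ⟨g, rfl⟩ := hx; exact ⟨1, by rw [hM, one_smul]⟩
    | zero => exact ⟨0, by simp⟩
    | add x y _ _ hx hy =>
      obtain ⟨a, ha⟩ := hx
      obtain ⟨b, hb⟩ := hy
      exact ⟨a + b, by rw [add_mul, ha, hb, add_smul]⟩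
    | smul a x _ hx =>
      obtain ⟨b, hb⟩ := hx
      exact ⟨a * b, by rw [smul_mul_assoc, hb, mul_smul]⟩
  obtain ⟨a, b, hab⟩ : ∃ a b, M a b ≠ 0 := by
    by_contra! h
    exact hM0 (Matrix.ext h)
  -- `E_ia M` is row `a` of `M` moved to row `i`. For `i ≠ a` it cannot be a multiple of `M`, so the
  -- dimension is `1`.
  have huniq (i : n) : i = a := by
    by_contra hi
    obtain ⟨c, hc⟩ := hscal (Matrix.single i a 1)
    have h1 := congrFun (congrFun hc a) b
    have h2 := congrFun (congrFun hc i) b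
    rw [Matrix.single_mul_apply_of_ne _ _ _ _ _ (Ne.symm hi), Matrix.smul_apply, smul_eq_mul,
      eq_comm, mul_eq_zero, or_iff_left hab] at h1
    rw [Matrix.single_mul_apply_same, h1] at h2
    simp [hab] at h2
  have hg := congrFun (congrFun (hM g) a) b
  rw [Matrix.mul_apply, Finset.sum_eq_single a (fun j _ hj => absurd (huniq j) hj) (by simp)] at hg
  ext i j
  rw [huniq i, huniq j, Matrix.one_apply_eq]
  exact mul_right_cancel₀ hab (hg.trans (one_mul _).symm)

theorem card_eq_one_of_forall_eq_one [Nonempty n] {ρ : G →* Matrix n n ℂ}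
    (hρ : Submodule.span ℂ (Set.range ρ) = ⊤) (h1 : ∀ g, ρ g = 1) : Fintype.card n = 1 := by
  have hr : Set.range ρ = {1} := by
    ext x; simp [h1, eq_comm]
  rw [hr] at hρ
  have h := finrank_span_singleton (K := ℂ) (one_ne_zero (α := Matrix n n ℂ))
  rw [hρ, finrank_top, Module.finrank_matrix, Module.finrank_self, mul_one] at h
  exact Nat.eq_one_of_mul_eq_one_right h

end Irreducible

end MonoidHom

/-! ### Decomposition of the group algebra -/

/-- The complex irreducible representations of a finite group, the orthogonality of the columns of
`1` and `g ≠ 1` in the character table, and the uniqueness of the trivial representation. -/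
theorem exists_irreducible_representations (G : Type*) [Group G] [Finite G] :
    ∃ (k : ℕ) (d : Fin k → ℕ) (ρ : ∀ i, G →* Matrix (Fin (d i)) (Fin (d i)) ℂ),
      (∀ i, NeZero (d i)) ∧ (∀ i, Submodule.span ℂ (Set.range (ρ i)) = ⊤) ∧
      (∀ g : G, g ≠ 1 → ∑ i, (d i : ℂ) * (ρ i g).trace = 0) ∧ ∃! i, ∀ g, ρ i g = 1 := by
  classical
  have := Fintype.ofFinite G
  have hfin : Module.Finite ℂ (MonoidAlgebra ℂ G) := Module.Finite.of_basis (MonoidAlgebra.basis G ℂ)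
  obtain ⟨k, d, hd, ⟨e⟩⟩ :=
    IsSemisimpleRing.exists_algEquiv_pi_matrix_of_isAlgClosed ℂ (MonoidAlgebra ℂ G)
  let ev (i : Fin k) := (Pi.evalAlgHom ℂ (fun i => Matrix (Fin (d i)) (Fin (d i)) ℂ) i).comp
    e.toAlgHom
  have hev (i : Fin k) (x) : ev i x = e x i := rfl
  have hof : Submodule.span ℂ (Set.range (MonoidAlgebra.of ℂ G)) = ⊤ := by
    have := (MonoidAlgebra.basis G ℂ).span_eq
    convert this using 3
    ext g
    simp [MonoidAlgebra.basis]
  let ρ (i : Fin k) : G →* Matrix (Fin (d i)) (Fin (d i)) ℂ :=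
    (ev i).toRingHom.toMonoidHom.comp (MonoidAlgebra.of ℂ G)
  have hρ (i : Fin k) (g : G) : ρ i g = e (MonoidAlgebra.of ℂ G g) i := rfl
  have hsurj (i : Fin k) : Function.Surjective (ev i) := by
    intro M
    obtain ⟨x, hx⟩ := e.surjective (Pi.single i M)
    exact ⟨x, by rw [hev, hx, Pi.single_eq_same]⟩
  have hspan (i : Fin k) : Submodule.span ℂ (Set.range (ρ i)) = ⊤ := by
    have hr : Set.range (ρ i) = (ev i).toLinearMap '' Set.range (MonoidAlgebra.of ℂ G) := by
      rw [← Set.range_comp]; rfl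
    rw [hr, Submodule.span_image, hof, Submodule.map_top, LinearMap.range_eq_top]
    exact hsurj i
  refine ⟨k, d, ρ, hd, hspan, ?_, ?_⟩
  · intro g hg
    -- Trace of left multiplication by `g` on `ℂ[G]`, computed twice: the sum over the matrix blocks
    -- equals `0`, as `g ≠ 1` fixes no basis element.
    have h1 := Matrix.trace_mulLeft_pi d (e (MonoidAlgebra.of ℂ G g))
    have h2 : LinearMap.mulLeft ℂ (e (MonoidAlgebra.of ℂ G g)) =
        e.toLinearEquiv.conj (LinearMap.mulLeft ℂ (MonoidAlgebra.of ℂ G g)) := by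
      refine LinearMap.ext fun x => ?_
      simp [LinearEquiv.conj_apply]
    rw [h2, LinearMap.trace_conj', LinearMap.trace_eq_matrix_trace ℂ (MonoidAlgebra.basis G ℂ)] at h1
    refine h1.symm.trans (Finset.sum_eq_zero fun x _ => ?_)
    rw [Matrix.diag_apply, LinearMap.toMatrix_apply]
    simp [MonoidAlgebra.basis, hg]
  · have hex : ∃ i, ∀ g, ρ i g = 1 := by
      -- The sum of all group elements is fixed by `G` and nonzero, so some component of it is a
      -- nonzero fixed matrix.
      let s : MonoidAlgebra ℂ G := ∑ g, MonoidAlgebra.of ℂ G g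
      have hs0 : s ≠ 0 := by
        intro h
        have h' := congrArg (MonoidAlgebra.lift ℂ ℂ G 1) h
        simp [s] at h'
      have hs (g : G) : MonoidAlgebra.of ℂ G g * s = s := by
        rw [Finset.mul_sum]
        simp_rw [← map_mul]
        exact Fintype.sum_equiv (Equiv.mulLeft g) _ _ fun _ => rfl
      obtain ⟨i, hi⟩ : ∃ i, e s i ≠ 0 := by
        by_contra! h
        exact hs0 (e.injective (by rw [map_zero]; exact funext h))
      refine ⟨i, MonoidHom.eq_one_of_mul_eq_self (hspan i) hi fun g => ?_⟩
      rw [hρ, ← Pi.mul_apply, ← map_mul, hs]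
    obtain ⟨i, hi⟩ := hex
    refine ⟨i, hi, fun j hj => ?_⟩
    by_contra hij
    -- A trivial component is the augmentation, so two of them would agree on every element,
    -- including the idempotent of one block.
    have haug (l : Fin k) (hl : ∀ g, ρ l g = 1) (x : MonoidAlgebra ℂ G) :
        ev l x = MonoidAlgebra.lift ℂ ℂ G 1 x • 1 := by
      have hx : x ∈ Submodule.span ℂ (Set.range (MonoidAlgebra.of ℂ G)) := hof ▸ Submodule.mem_top
      induction hx using Submodule.span_induction with
      | mem x hx =>
        obtain ⟨g, rfl⟩ := hx
        rw [hev, ← hρ, hl, MonoidAlgebra.lift_of, MonoidHom.one_apply, one_smul]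
      | zero => simp
      | add x y _ _ hx hy => rw [map_add, map_add, hx, hy, add_smul]
      | smul a x _ hx => rw [map_smul, map_smul, hx, smul_assoc]
    obtain ⟨x, hx⟩ := e.surjective (Pi.single i 1)
    have h1 := haug i hi x
    have h2 := haug j hj x
    rw [hev, hx, Pi.single_eq_same] at h1
    rw [hev, hx, Pi.single_eq_of_ne hij, eq_comm, smul_eq_zero, or_iff_left one_ne_zero] at h2
    rw [h2, zero_smul] at h1
    exact one_ne_zero h1

/-! ### Burnside's theorem -/

/-- In a finite simple group, a nontrivial element whose conjugacy class has prime power size can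
only exist if the group is commutative. -/
theorem IsSimpleGroup.mul_comm_of_card_conjClass {G : Type*} [Group G] [Finite G] [IsSimpleGroup G]
    {p k : ℕ} (hp : p.Prime) {g : G} (hg : g ≠ 1)
    (hcard : Nat.card (ConjClasses.mk g).carrier = p ^ k) (a b : G) : a * b = b * a := by
  by_contra hab
  obtain ⟨r, d, ρ, hd, hspan, horth, i₀, hi₀, huniq⟩ := exists_irreducible_representations G
  have hker (i : Fin r) (hi : i ≠ i₀) : Function.Injective (ρ i) := by
    rcases (ρ i).normal_ker.eq_bot_or_eq_top with h | h
    · exact (MonoidHom.ker_eq_bot_iff _).1 h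
    · refine absurd (huniq i fun x => ?_) hi
      rw [← MonoidHom.mem_ker, h]
      trivial
  have hns (i : Fin r) (hi : i ≠ i₀) :
      ¬ ∃ z, ρ i g = algebraMap ℂ (Matrix (Fin (d i)) (Fin (d i)) ℂ) z := by
    rintro ⟨z, hz⟩
    have hc : g ∈ Subgroup.center G := by
      rw [Subgroup.mem_center_iff]
      intro x
      refine hker i hi ?_
      rw [map_mul, map_mul, hz]
      exact (Algebra.commutes z (ρ i x)).symm
    rcases (inferInstance : (Subgroup.center G).Normal).eq_bot_or_eq_top with h | h
    · rw [h, Subgroup.mem_bot] at hc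
      exact hg hc
    · have ha : b ∈ Subgroup.center G := h ▸ Subgroup.mem_top b
      exact hab (Subgroup.mem_center_iff.1 ha a)
  have hm : 0 < orderOf g := orderOf_pos g
  -- Either `p` divides the degree, or the degree is prime to the class size and the character
  -- vanishes at `g`.
  have hterm (i : Fin r) (hi : i ≠ i₀) :
      ∃ x : ℂ, IsIntegral ℤ x ∧ (d i : ℂ) * (ρ i g).trace = p * x := by
    by_cases hpd : p ∣ d i
    · obtain ⟨c, hc⟩ := hpd
      refine ⟨c * (ρ i g).trace, (isIntegral_algebraMap (R := ℤ) (x := (c : ℤ))).mul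
        (Matrix.isIntegral_trace_of_pow_eq_one hm ?_), ?_⟩
      · rw [← map_pow, pow_orderOf_eq_one, map_one]
      · have hc' : (d i : ℂ) = p * c := by exact_mod_cast hc
        linear_combination (ρ i g).trace * hc'
    · refine ⟨0, isIntegral_zero, ?_⟩
      have hcop : (Nat.card (ConjClasses.mk g).carrier).Coprime (Fintype.card (Fin (d i))) := by
        rw [hcard, Fintype.card_fin]
        exact ((Nat.Prime.coprime_iff_not_dvd hp).2 hpd).pow_left k
      rcases MonoidHom.trace_eq_zero_or_eq_scalar_of_coprime (hspan i) g hcop with h | h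
      · rw [h, mul_zero, mul_zero]
      · exact absurd h (hns i hi)
  have hd1 : d i₀ = 1 := by
    simpa using MonoidHom.card_eq_one_of_forall_eq_one (hspan i₀) hi₀
  choose! x hxint hx using hterm
  have hsum := horth g hg
  rw [← Finset.add_sum_erase _ _ (Finset.mem_univ i₀), hi₀, Matrix.trace_one, Fintype.card_fin, hd1,
    Finset.sum_congr rfl fun i hi => hx i (Finset.ne_of_mem_erase hi), ← Finset.mul_sum] at hsum
  -- Orthogonality now reads `1 + p y = 0`, so `-1/p` would be an algebraic integer.
  set y := ∑ i ∈ Finset.univ.erase i₀, x i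
  have hyint : IsIntegral ℤ y := IsIntegral.sum _ fun i hi => hxint i (Finset.ne_of_mem_erase hi)
  have hp0 : (p : ℚ) ≠ 0 := by exact_mod_cast hp.ne_zero
  have hp0' : (p : ℂ) ≠ 0 := by exact_mod_cast hp.ne_zero
  have hy' : y = algebraMap ℚ ℂ (-1 / p) := by
    simp only [map_div₀, map_neg, map_one, map_natCast]
    rw [eq_div_iff hp0']
    push_cast at hsum
    linear_combination hsum
  rw [hy', isIntegral_algebraMap_iff (algebraMap ℚ ℂ).injective] at hyint
  obtain ⟨z, hz⟩ := IsIntegrallyClosed.isIntegral_iff.1 hyint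
  rw [eq_div_iff hp0] at hz
  have hz' : z * p = -1 := by
    rw [eq_intCast] at hz
    exact_mod_cast hz
  have : (p : ℤ) ∣ 1 := ⟨-z, by linarith⟩
  exact hp.one_lt.ne' (by exact_mod_cast Int.eq_one_of_dvd_one (by positivity) this)

namespace Group

theorem IsPGroup.isSolvable_of_finite {G : Type*} [Group G] [Finite G] {p : ℕ} (hp : p.Prime)
    (h : IsPGroup p G) : IsSolvable G := by
  have := Fact.mk hp
  have := h.isNilpotent
  infer_instance

theorem card_conjClass_eq_index_centralizer {G : Type*} [Group G] [Finite G] (g : G) :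
    Nat.card (ConjClasses.mk g).carrier = (Subgroup.centralizer {g}).index := by
  classical
  have := Fintype.ofFinite G
  have := Fintype.ofFinite (ConjClasses.mk g).carrier
  have := Fintype.ofFinite (MulAction.stabilizer (ConjAct G) g)
  rw [Nat.card_eq_fintype_card, ConjClasses.card_carrier, ← Nat.card_eq_fintype_card,
    ← Nat.card_eq_fintype_card, ← Subgroup.nat_card_centralizer_nat_card_stabilizer,
    ← (Subgroup.centralizer {g}).card_mul_index, Nat.mul_div_cancel_left _ Nat.card_pos]

/-- **Burnside's theorem**: a finite group whose order has at most two prime divisors is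
solvable. -/
theorem isSolvable_of_card_dvd_pow_mul_pow {p q a b : ℕ} (hp : p.Prime) (hq : q.Prime)
    {G : Type*} [Group G] [Finite G] (hG : Nat.card G ∣ p ^ a * q ^ b) : IsSolvable G := by
  induction hn : Nat.card G using Nat.strong_induction_on generalizing G with
  | _ n ih =>
  have := Fact.mk hp
  have := Fact.mk hq
  by_cases hqG : q ∣ Nat.card G
  swap
  · have hc : (Nat.card G).Coprime (q ^ b) :=
      (((Nat.Prime.coprime_iff_not_dvd hq).2 hqG).pow_left b).symm
    exact IsPGroup.isSolvable_of_finite hp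
      (_root_.IsPGroup.of_card_dvd_pow (hc.dvd_of_dvd_mul_right hG))
  have hnt : Nontrivial G := Finite.one_lt_card_iff_nontrivial.1
    (hq.one_lt.trans_le (Nat.le_of_dvd Nat.card_pos hqG))
  by_cases hs : IsSimpleGroup G
  · obtain ⟨Q⟩ : Nonempty (Sylow q G) := inferInstance
    have hQ : Nontrivial Q := by
      rw [Subgroup.nontrivial_iff_ne_bot]
      exact Q.ne_bot_of_dvd_card hqG
    have := Q.isPGroup'.center_nontrivial
    -- A central element of a Sylow `q`-subgroup has a centralizer containing that subgroup, so its
    -- class size is a power of `p`.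
    obtain ⟨⟨z, hzc⟩, hz1⟩ := exists_ne (1 : Subgroup.center Q)
    have hz : (z : G) ≠ 1 := by
      intro h
      exact hz1 (Subtype.ext (Subtype.ext h))
    have hle : (Q : Subgroup G) ≤ Subgroup.centralizer {(z : G)} := by
      intro x hx
      rw [Subgroup.mem_centralizer_singleton_iff]
      exact congrArg Subtype.val (Subgroup.mem_center_iff.1 hzc ⟨x, hx⟩)
    have hdvd : (Q : Subgroup G).index ∣ p ^ a := by
      refine Nat.Coprime.dvd_of_dvd_mul_right ?_ ((Subgroup.index_dvd_card _).trans hG)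
      exact (((Nat.Prime.coprime_iff_not_dvd hq).2 Q.not_dvd_index).pow_left b).symm
    obtain ⟨k, -, hk⟩ := (Nat.dvd_prime_pow hp).1 ((Subgroup.index_dvd_of_le hle).trans hdvd)
    exact isSolvable_of_comm (IsSimpleGroup.mul_comm_of_card_conjClass hp hz
      ((card_conjClass_eq_index_centralizer _).trans hk))
  · obtain ⟨H, hH, hbot, htop⟩ : ∃ H : Subgroup G, H.Normal ∧ H ≠ ⊥ ∧ H ≠ ⊤ := by
      by_contra! h
      exact hs ⟨fun H hH => or_iff_not_imp_left.2 fun hb => h H hH hb⟩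
    have hmul := H.card_mul_index
    have h1 : 1 < Nat.card H := (Subgroup.one_lt_card_iff_ne_bot H).2 hbot
    have h2 : 1 < H.index := by
      have h0 : H.index ≠ 0 := Subgroup.FiniteIndex.index_ne_zero
      have h1 : H.index ≠ 1 := fun h => htop (Subgroup.index_eq_one.1 h)
      omega
    rw [isSolvable_iff_subgroup_quotient H]
    refine ⟨ih _ ?_ (H.card_subgroup_dvd_card.trans hG) rfl,
      ih _ ?_ ((Subgroup.card_quotient_dvd_card H).trans hG) rfl⟩
    · rw [← hn, ← hmul]
      exact lt_mul_of_one_lt_right (by omega) h2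
    · rw [← hn, ← hmul]
      exact lt_mul_of_one_lt_left (by change 0 < H.index; omega) h1

/-- A nontrivial finite solvable group has a nontrivial normal subgroup of prime power order. -/
theorem IsSolvable.exists_normal_isPGroup {G : Type*} [Group G] [Finite G] [Nontrivial G]
    [hG : IsSolvable G] : ∃ (p : ℕ) (L : Subgroup G), p.Prime ∧ L.Normal ∧ L ≠ ⊥ ∧ IsPGroup p L := by
  classical
  -- The last nontrivial derived subgroup is abelian; its Sylow subgroups are characteristic in it,
  -- hence normal in `G`.
  obtain ⟨n, hn, hmin⟩ : ∃ n, derivedSeries G n ≠ ⊥ ∧ derivedSeries G (n + 1) = ⊥ := by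
    have h0 : Nat.find hG.solvable ≠ 0 := by
      intro h
      have := Nat.find_spec hG.solvable
      rw [h, derivedSeries_zero] at this
      exact top_ne_bot this
    obtain ⟨n, hn⟩ := Nat.exists_eq_succ_of_ne_zero h0
    refine ⟨n, Nat.find_min hG.solvable (by omega), ?_⟩
    have := Nat.find_spec hG.solvable
    rwa [hn] at this
  set D := derivedSeries G n with hD
  have hDn : D.Normal := derivedSeries_normal G n
  have hcomm (x y : D) : x * y = y * x := by
    rw [derivedSeries_succ, ← hD, Subgroup.commutator_eq_bot_iff_le_centralizer] at hmin
    exact Subtype.ext (Subgroup.mem_centralizer_iff.1 (hmin y.2) x x.2)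
  have hcard : Nat.card D ≠ 1 := fun h => hn (Subgroup.card_eq_one.1 h)
  obtain ⟨p, hp, hpD⟩ := Nat.exists_prime_and_dvd hcard
  have := Fact.mk hp
  obtain ⟨P⟩ : Nonempty (Sylow p D) := inferInstance
  have hPn : (P : Subgroup D).Normal := ⟨fun x hx g => by
    rwa [hcomm g x, mul_assoc, mul_inv_cancel, mul_one]⟩
  have hPc : (P : Subgroup D).Characteristic := P.characteristic_of_normal hPn
  refine ⟨p, (P : Subgroup D).map D.subtype, hp, ConjAct.normal_of_characteristic_of_normal, ?_,
    P.isPGroup'.map _⟩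
  rw [Ne, Subgroup.map_eq_bot_iff_of_injective _ D.subtype_injective]
  exact P.ne_bot_of_dvd_card hpD

end Group

/-! ### Wielandt's theorem -/

namespace Subgroup

/-- `H` acts transitively on `G ⧸ K`: the orbit of the base coset has `|H : H ∩ K|` elements, which
by coprimality is a multiple of `|G : K|`. -/
theorem exists_mul_eq_of_coprime_index {G : Type*} [Group G] [Finite G] {H K : Subgroup G}
    (h : H.index.Coprime K.index) (g : G) : ∃ x ∈ H, ∃ y ∈ K, x * y = g := by
  have hst : MulAction.stabilizer H ((1 : G) : G ⧸ K) = K.subgroupOf H := by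
    ext x
    rw [MulAction.mem_stabilizer_iff, mem_subgroupOf]
    change ((((x : G) * 1 : G)) : G ⧸ K) = ((1 : G) : G ⧸ K) ↔ _
    rw [mul_one, eq_comm, QuotientGroup.eq]
    simp
  have hidx : K.index ∣ K.relIndex H := by
    have h1 : (K ⊓ H).index = K.relIndex H * H.index := by
      rw [← relIndex_mul_index (inf_le_right : K ⊓ H ≤ H), inf_relIndex_right]
    exact h.symm.dvd_of_dvd_mul_right (h1 ▸ index_dvd_of_le inf_le_left)
  have horb : MulAction.orbit H ((1 : G) : G ⧸ K) = Set.univ := by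
    refine Set.eq_of_subset_of_ncard_le (Set.subset_univ _) ?_
    rw [Set.ncard_univ, ← MulAction.index_stabilizer, hst]
    exact Nat.le_of_dvd (Nat.pos_of_ne_zero FiniteIndex.index_ne_zero) hidx
  obtain ⟨x, hx⟩ : (g : G ⧸ K) ∈ MulAction.orbit H ((1 : G) : G ⧸ K) := horb ▸ Set.mem_univ _
  refine ⟨x, x.2, (x : G)⁻¹ * g, ?_, by simp⟩
  rw [← QuotientGroup.eq, ← hx]
  change ((x : G) : G ⧸ K) = (((x : G) * 1 : G) : G ⧸ K)
  rw [mul_one]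

/-- A normal `p`-subgroup of `H` has its normal closure inside `K`, if the indices of `H` and `K`
are coprime and the index of `K` is prime to `p`. -/
theorem normalClosure_map_le_of_coprime_index {G : Type*} [Group G] [Finite G] {H K : Subgroup G}
    (h : H.index.Coprime K.index) {p : ℕ} (hp : p.Prime) (hpK : ¬ p ∣ K.index) (L : Subgroup H)
    [hL : L.Normal] (hLp : IsPGroup p L) :
    normalClosure (L.map H.subtype : Set G) ≤ K := by
  have := Fact.mk hp
  -- The `p`-group `L` fixes a coset `xK`, so `x⁻¹Lx ≤ K`. Writing `x = uv` with `u ∈ H` normalizing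
  -- `L` and `v ∈ K` gives `L ≤ K`.
  obtain ⟨x, hx⟩ := (hLp.map H.subtype).nonempty_fixed_point_of_prime_not_dvd_card (G ⧸ K) hpK
  obtain ⟨x, rfl⟩ := QuotientGroup.mk_surjective x
  have hconj {u l : G} (hu : u ∈ H) (hl : l ∈ L.map H.subtype) :
      u * l * u⁻¹ ∈ L.map H.subtype := by
    obtain ⟨l, hl, rfl⟩ := hl
    exact ⟨⟨u, hu⟩ * l * ⟨u, hu⟩⁻¹, hL.conj_mem l hl _, rfl⟩
  have hxL {l : G} (hl : l ∈ L.map H.subtype) : x⁻¹ * l * x ∈ K := by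
    have h1 := hx ⟨l, hl⟩
    change ((l * x : G) : G ⧸ K) = (x : G ⧸ K) at h1
    rw [eq_comm, QuotientGroup.eq] at h1
    rwa [mul_assoc]
  obtain ⟨u, hu, v, hv, rfl⟩ := exists_mul_eq_of_coprime_index h x
  have hLK {l : G} (hl : l ∈ L.map H.subtype) : l ∈ K := by
    have h1 := hxL (hconj hu hl)
    have h2 := mul_mem (mul_mem hv h1) (inv_mem hv)
    convert h2 using 1
    group
  rw [normalClosure, closure_le]
  intro y hy
  obtain ⟨l, hl, hly⟩ := Group.mem_conjugatesOfSet_iff.1 hy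
  obtain ⟨g, rfl⟩ := isConj_iff.1 hly
  -- With `g = cd`, the factor `d ∈ H` keeps `L` in place and `c ∈ K` keeps the result in `K`.
  obtain ⟨c, hc, d, hd, rfl⟩ := exists_mul_eq_of_coprime_index h.symm g
  have h2 := mul_mem (mul_mem hc (hLK (hconj hd hl))) (inv_mem hc)
  rw [SetLike.mem_coe]
  convert h2 using 1
  group

end Subgroup

namespace Group

/-- **Wielandt's theorem**: a finite group with three solvable subgroups of pairwise coprime
indices is solvable. -/
theorem isSolvable_of_coprime_index {G : Type*} [Group G] [Finite G] {H₁ H₂ H₃ : Subgroup G}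
    [hs₁ : IsSolvable H₁] [hs₂ : IsSolvable H₂] [hs₃ : IsSolvable H₃]
    (h₁₂ : H₁.index.Coprime H₂.index) (h₁₃ : H₁.index.Coprime H₃.index)
    (h₂₃ : H₂.index.Coprime H₃.index) : IsSolvable G := by
  induction hn : Nat.card G using Nat.strong_induction_on generalizing G with
  | _ n ih =>
  rcases eq_or_ne H₁ ⊥ with rfl | hbot
  · rw [Subgroup.index_bot] at h₁₂
    have h2 : H₂ = ⊤ := Subgroup.index_eq_one.1 (Nat.eq_one_of_dvd_coprimes h₁₂
      (Subgroup.index_dvd_card _) dvd_rfl)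
    subst h2
    exact isSolvable_of_surjective (f := (⊤ : Subgroup G).subtype) fun x => ⟨⟨x, trivial⟩, rfl⟩
  have : Nontrivial H₁ := (Subgroup.nontrivial_iff_ne_bot _).2 hbot
  obtain ⟨p, L, hp, hLn, hL, hLp⟩ := IsSolvable.exists_normal_isPGroup (G := H₁)
  set K := Subgroup.normalClosure (L.map H₁.subtype : Set G)
  have hKs : IsSolvable K := by
    -- `p` divides at most one of the two coprime indices, so `K` lies in the solvable `H₂` or `H₃`.
    by_cases hp2 : p ∣ H₂.index
    · have hp3 : ¬ p ∣ H₃.index := fun h => hp.one_lt.ne' (Nat.eq_one_of_dvd_coprimes h₂₃ hp2 h)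
      exact isSolvable_of_isSolvable_injective (Subgroup.inclusion_injective
        (Subgroup.normalClosure_map_le_of_coprime_index h₁₃ hp hp3 L hLp))
    · exact isSolvable_of_isSolvable_injective (Subgroup.inclusion_injective
        (Subgroup.normalClosure_map_le_of_coprime_index h₁₂ hp hp2 L hLp))
  have hKbot : K ≠ ⊥ := by
    intro h
    have hle : L.map H₁.subtype ≤ K := Subgroup.subset_normalClosure
    rw [h, le_bot_iff, Subgroup.map_eq_bot_iff_of_injective _ H₁.subtype_injective] at hle
    exact hL hle
  have hmap (H : Subgroup G) [IsSolvable H] : IsSolvable (H.map (QuotientGroup.mk' K)) :=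
    isSolvable_of_surjective ((QuotientGroup.mk' K).subgroupMap_surjective H)
  have hidx (H : Subgroup G) : (H.map (QuotientGroup.mk' K)).index ∣ H.index :=
    Subgroup.index_map_dvd _ (QuotientGroup.mk'_surjective K)
  have := hmap H₁
  have := hmap H₂
  have := hmap H₃
  rw [isSolvable_iff_subgroup_quotient K]
  refine ⟨hKs, ih _ ?_ (h₁₂.of_dvd (hidx H₁) (hidx H₂)) (h₁₃.of_dvd (hidx H₁) (hidx H₃))
    (h₂₃.of_dvd (hidx H₂) (hidx H₃)) rfl⟩
  rw [← hn, ← K.card_mul_index]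
  exact lt_mul_of_one_lt_left (Nat.pos_of_ne_zero Subgroup.FiniteIndex.index_ne_zero)
    ((Subgroup.one_lt_card_iff_ne_bot K).2 hKbot)

end Group

/-! ### Characteristic complements in nilpotent groups -/

namespace Subgroup

/-- A normal Hall subgroup is characteristic. -/
theorem characteristic_of_coprime_card_index {G : Type*} [Group G] [Finite G] (K : Subgroup G)
    [K.Normal] (h : (Nat.card K).Coprime K.index) : K.Characteristic := by
  -- `K` is the set of solutions of `x ^ |K| = 1`, a condition that automorphisms respect.
  have hK (x : G) : x ∈ K ↔ x ^ Nat.card K = 1 := by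
    constructor
    · intro hx
      exact congrArg Subtype.val (pow_card_eq_one' (x := (⟨x, hx⟩ : K)))
    · intro hx
      rw [← QuotientGroup.eq_one_iff, ← orderOf_eq_one_iff]
      refine Nat.eq_one_of_dvd_coprimes h (orderOf_dvd_of_pow_eq_one ?_) (_root_.orderOf_dvd_natCard _)
      rw [← QuotientGroup.mk_pow, hx, QuotientGroup.mk_one]
  refine characteristic_iff_le_comap.2 fun φ x hx => ?_
  rw [mem_comap, hK]
  change φ x ^ _ = 1
  rw [← map_pow, (hK x).1 hx, map_one]

end Subgroup

/-- A finite nilpotent group has a characteristic `p`-complement for every prime divisor `p` of its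
order. -/
theorem Group.IsNilpotent.exists_characteristic_complement {G : Type*} [Group G] [Finite G]
    [hG : Group.IsNilpotent G] {p : ℕ} (hp : p.Prime) (hpG : p ∣ Nat.card G) :
    ∃ K : Subgroup G, K.Characteristic ∧ ¬ p ∣ Nat.card K ∧ ∃ k, K.index = p ^ k := by
  have := Fact.mk hp
  obtain ⟨e⟩ := (Group.isNilpotent_of_finite_tfae (G := G)).out 0 4 |>.1 hG
  obtain ⟨P⟩ : Nonempty (Sylow p G) := inferInstance
  let p' : (Nat.card G).primeFactors :=
    ⟨p, Nat.mem_primeFactors.2 ⟨hp, hpG, Nat.card_pos.ne'⟩⟩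
  -- A finite nilpotent group is the product of its Sylow subgroups; the complement is the kernel of
  -- the projection to the `p`-factor.
  let f : G →* P := ((Pi.evalMonoidHom (fun P : Sylow p G => (P : Subgroup G)) P).comp
    (Pi.evalMonoidHom (fun q : (Nat.card G).primeFactors => ∀ P : Sylow q G, (P : Subgroup G)) p')).comp
      e.symm.toMonoidHom
  have hf : Function.Surjective f :=
    ((Function.surjective_eval (β := fun P : Sylow p G => (P : Subgroup G)) P).comp
      (Function.surjective_eval
        (β := fun q : (Nat.card G).primeFactors => ∀ P : Sylow q G, (P : Subgroup G)) p')).comp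
      e.symm.surjective
  have hidx : f.ker.index = Nat.card P := by
    rw [Subgroup.index_ker, MonoidHom.range_eq_top.2 hf, Subgroup.card_top]
  have hcard : Nat.card f.ker = (P : Subgroup G).index := by
    have h1 := f.ker.card_mul_index
    rw [← (P : Subgroup G).card_mul_index, hidx, mul_comm] at h1
    exact Nat.eq_of_mul_eq_mul_left Nat.card_pos h1
  refine ⟨f.ker, Subgroup.characteristic_of_coprime_card_index _ ?_, ?_, ?_⟩
  · rw [hidx, hcard]
    exact P.card_coprime_index.symm
  · rw [hcard]
    exact P.not_dvd_index
  · rw [hidx]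
    exact IsPGroup.iff_card.1 P.isPGroup'

/-! ### The Fitting subgroup -/

section Fitting

variable {N : Type*} [Group N]

namespace Subgroup

theorem card_mul_relIndex {H K : Subgroup N} (h : H ≤ K) :
    Nat.card H * H.relIndex K = Nat.card K := by
  rw [← relIndex_bot_left, ← relIndex_bot_left]
  exact relIndex_mul_relIndex _ _ _ bot_le h

theorem not_dvd_card_sup {p : ℕ} (hp : p.Prime) {A B : Subgroup N} [B.Normal]
    (hA : ¬ p ∣ Nat.card A) (hB : ¬ p ∣ Nat.card B) : ¬ p ∣ Nat.card (A ⊔ B : Subgroup N) := by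
  rw [← card_mul_relIndex (le_sup_right : B ≤ A ⊔ B), relIndex_sup_right]
  exact hp.not_dvd_mul hB fun h => hA (h.trans (B.relIndex_dvd_card A))

theorem card_map_mk' {R : Subgroup N} [R.Normal] (K : Subgroup N) :
    Nat.card (K.map (QuotientGroup.mk' R)) = R.relIndex K := by
  have h : K.map (QuotientGroup.mk' R) = ((QuotientGroup.mk' R).comp K.subtype).range := by
    rw [MonoidHom.range_comp, range_subtype]
  rw [h, ← index_ker, ← MonoidHom.comap_ker, QuotientGroup.ker_mk']
  rfl

end Subgroup

theorem fittingSubgroup_characteristic : (fittingSubgroup N).Characteristic := by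
  refine Subgroup.characteristic_iff_map_le.2 fun φ => ?_
  rw [fittingSubgroup, sSup_eq_iSup, Subgroup.map_iSup]
  refine iSup_le fun K => ?_
  rw [Subgroup.map_iSup]
  refine iSup_le fun ⟨hK, hKn⟩ => le_iSup₂_of_le (K.map φ.toMonoidHom) ⟨?_, ?_⟩ le_rfl
  · exact hK.map _ φ.surjective
  · exact Group.nilpotent_of_surjective (φ.toMonoidHom.subgroupMap K)
      (φ.toMonoidHom.subgroupMap_surjective K)

/-- **Fitting's theorem** for finite groups: the Fitting subgroup is nilpotent. -/
theorem isNilpotent_fittingSubgroup [Finite N] : Group.IsNilpotent (fittingSubgroup N) := by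
  refine (Group.isNilpotent_of_finite_tfae.out 0 3).2 fun p _ P => ?_
  have hp : Fact p.Prime := ‹_›
  obtain ⟨Q⟩ : Nonempty (Sylow p N) := inferInstance
  -- `R` is `O_p(N)`. It contains the Sylow `p`-subgroup of each normal nilpotent `K`, which is
  -- characteristic in `K` and so normal in `N`. Thus `KR/R` has order prime to `p`, and this passes
  -- to joins.
  set R := (Q : Subgroup N).normalCore
  have hRp : IsPGroup p R := Q.isPGroup'.to_le (Subgroup.normalCore_le _)
  have hprime {K : Subgroup N} (hK : K.Normal) (hKn : Group.IsNilpotent K) :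
      ¬ p ∣ R.relIndex K := by
    obtain ⟨S⟩ : Nonempty (Sylow p K) := inferInstance
    have hSc : (S : Subgroup K).Characteristic := S.characteristic_of_normal inferInstance
    have hSn : ((S : Subgroup K).map K.subtype).Normal := ConjAct.normal_of_characteristic_of_normal
    have hSR : (S : Subgroup K).map K.subtype ≤ R :=
      Subgroup.normal_le_normalCore.2 ((S.isPGroup'.map _).le_sylow_of_normal Q)
    intro h
    exact S.not_dvd_index (h.trans (Subgroup.index_dvd_of_le (Subgroup.map_le_iff_le_comap.1 hSR)))
  have hF : ¬ p ∣ R.relIndex (fittingSubgroup N) := by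
    have hfin : {K : Subgroup N | K.Normal ∧ Group.IsNilpotent K}.Finite := Set.toFinite _
    have hind : (hfin.toFinset.sup id).Normal ∧
        ¬ p ∣ Nat.card ((hfin.toFinset.sup id).map (QuotientGroup.mk' R)) := by
      refine Finset.sup_induction (p := fun K : Subgroup N =>
        K.Normal ∧ ¬ p ∣ Nat.card (K.map (QuotientGroup.mk' R))) ?_ ?_ ?_
      · refine ⟨inferInstance, ?_⟩
        rw [Subgroup.map_bot, Subgroup.card_bot]
        exact hp.out.not_dvd_one
      · rintro A ⟨hA, hAp⟩ B ⟨hB, hBp⟩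
        have := hB.map _ (QuotientGroup.mk'_surjective R)
        refine ⟨Subgroup.sup_normal A B, ?_⟩
        rw [Subgroup.map_sup]
        exact Subgroup.not_dvd_card_sup hp.out hAp hBp
      · intro K hK
        obtain ⟨hK, hKn⟩ := hfin.mem_toFinset.1 hK
        refine ⟨hK, ?_⟩
        rw [id, Subgroup.card_map_mk']
        exact hprime hK hKn
    rw [Finset.sup_id_eq_sSup, hfin.coe_toFinset, Subgroup.card_map_mk'] at hind
    exact hind.2
  -- Hence `R ∩ Fit(N)` is a normal Sylow `p`-subgroup of `Fit(N)`.
  let P₀ : Sylow p (fittingSubgroup N) := (hRp.comap_subtype (K := fittingSubgroup N)).toSylow hF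
  have hP₀ : (P₀ : Subgroup (fittingSubgroup N)).Normal :=
    inferInstanceAs (R.subgroupOf (fittingSubgroup N)).Normal
  have := Sylow.unique_of_normal P₀ hP₀
  rw [Subsingleton.elim P P₀]
  exact hP₀

end Fitting

/-! ### Regular subgroups of the holomorph -/

section Regular

variable {N : Type*} [Group N] {𝒢 : Subgroup (Equiv.Perm N)}

theorem apply_mem_iff_of_mem_holomorph {σ : Equiv.Perm N} (hσ : σ ∈ holomorph N) (M : Subgroup N)
    [hM : M.Characteristic] (h1 : σ 1 ∈ M) (x : N) : σ x ∈ M ↔ x ∈ M := by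
  obtain ⟨η, φ, rfl⟩ := mem_holomorph.1 hσ
  change φ 1 * η⁻¹ ∈ M at h1
  change φ x * η⁻¹ ∈ M ↔ _
  rw [map_one, one_mul] at h1
  rw [M.mul_mem_cancel_right h1]
  have h := Subgroup.characteristic_iff_comap_eq.1 hM φ
  exact Subgroup.ext_iff.1 h x

/-- The elements of a subgroup of the holomorph that map `1` into a characteristic subgroup `M`
(and hence stabilize `M`). -/
def characteristicStabilizer (h𝒢 : 𝒢 ≤ holomorph N) (M : Subgroup N) [M.Characteristic] :
    Subgroup 𝒢 where
  carrier := {σ | (σ : Equiv.Perm N) 1 ∈ M}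
  one_mem' := M.one_mem
  mul_mem' {σ τ} hσ hτ := (apply_mem_iff_of_mem_holomorph (h𝒢 σ.2) M hσ _).2 hτ
  inv_mem' {σ} hσ := (apply_mem_iff_of_mem_holomorph (h𝒢 σ.2) M hσ _).1 (by
    change (σ : Equiv.Perm N) ((σ : Equiv.Perm N)⁻¹ 1) ∈ M
    rw [← Equiv.Perm.mul_apply, mul_inv_cancel]
    exact M.one_mem)

theorem card_characteristicStabilizer (h𝒢 : 𝒢 ≤ holomorph N) (hreg : IsRegularSubgroup 𝒢)
    (M : Subgroup N) [M.Characteristic] :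
    Nat.card (characteristicStabilizer h𝒢 M) = Nat.card M :=
  Nat.card_congr ((Equiv.ofBijective _ hreg).subtypeEquiv fun _ => Iff.rfl)

theorem Nat.exists_dvd_pow_mul_pow_or_three_primes {n : ℕ} (hn : n ≠ 0) :
    (∃ p q a b : ℕ, p.Prime ∧ q.Prime ∧ n ∣ p ^ a * q ^ b) ∨
      ∃ p q r : ℕ, p ∈ n.primeFactors ∧ q ∈ n.primeFactors ∧ r ∈ n.primeFactors ∧
        p ≠ q ∧ p ≠ r ∧ q ≠ r := by
  have hfac := Nat.prod_factorization_pow_eq_self hn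
  rw [Nat.prod_factorization_eq_prod_primeFactors] at hfac
  rcases Nat.lt_or_ge 2 n.primeFactors.card with h | h
  · obtain ⟨p, q, r, hp, hq, hr, h⟩ := Finset.two_lt_card_iff.1 h
    exact Or.inr ⟨p, q, r, hp, hq, hr, h⟩
  left
  interval_cases hc : n.primeFactors.card
  · rw [Finset.card_eq_zero] at hc
    rw [hc, Finset.prod_empty] at hfac
    exact ⟨2, 2, 0, 0, Nat.prime_two, Nat.prime_two, by rw [← hfac]; exact one_dvd _⟩
  · obtain ⟨p, hp⟩ := Finset.card_eq_one.1 hc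
    have hpp : p.Prime := Nat.prime_of_mem_primeFactors (n := n) (by simp [hp])
    rw [hp, Finset.prod_singleton] at hfac
    exact ⟨p, p, n.factorization p, 0, hpp, hpp, by rw [hfac, pow_zero, mul_one]⟩
  · obtain ⟨p, q, hpq, hp⟩ := Finset.card_eq_two.1 hc
    have hpp : p.Prime := Nat.prime_of_mem_primeFactors (n := n) (by simp [hp])
    have hqq : q.Prime := Nat.prime_of_mem_primeFactors (n := n) (by simp [hp])
    rw [hp, Finset.prod_pair hpq] at hfac
    exact ⟨p, q, n.factorization p, n.factorization q, hpp, hqq, by rw [hfac]⟩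

/-- The map from characteristic subgroups to stabilizers preserves inclusions and orders, hence
indices. So `p`-complements of `M` become subgroups of `p`-power index, solvable by induction, and
Burnside or Wielandt applies according to the number of primes. -/
theorem isSolvable_characteristicStabilizer [Finite N] (h𝒢 : 𝒢 ≤ holomorph N)
    (hreg : IsRegularSubgroup 𝒢) (M : Subgroup N) [M.Characteristic] [hMn : Group.IsNilpotent M] :
    Group.IsSolvable (characteristicStabilizer h𝒢 M) := by
  induction hn : Nat.card M using Nat.strong_induction_on generalizing M with
  | _ n ih =>
  have hcompl (p : ℕ) (hp : p ∈ (Nat.card M).primeFactors) :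
      ∃ H : Subgroup (characteristicStabilizer h𝒢 M), Group.IsSolvable H ∧ ∃ k, H.index = p ^ k := by
    have hpp := Nat.prime_of_mem_primeFactors hp
    have hpM := Nat.dvd_of_mem_primeFactors hp
    obtain ⟨K, hKc, hKp, k, hk⟩ := Group.IsNilpotent.exists_characteristic_complement hpp hpM
    have hle : K.map M.subtype ≤ M := Subgroup.map_subtype_le K
    have hcard : Nat.card (K.map M.subtype) = Nat.card K :=
      Nat.card_congr (K.equivMapOfInjective _ M.subtype_injective).symm.toEquiv
    have hlt : Nat.card (K.map M.subtype) < n := by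
      rw [hcard, ← hn]
      exact lt_of_le_of_ne (Subgroup.card_le_card_group K) fun h => hKp (h ▸ hpM)
    have hKn : Group.IsNilpotent (K.map M.subtype) :=
      Group.nilpotent_of_mulEquiv (K.equivMapOfInjective _ M.subtype_injective)
    have hsol := ih _ hlt (K.map M.subtype) rfl
    have hle' : characteristicStabilizer h𝒢 (K.map M.subtype) ≤ characteristicStabilizer h𝒢 M :=
      fun σ hσ => hle hσ
    refine ⟨(characteristicStabilizer h𝒢 (K.map M.subtype)).subgroupOf
      (characteristicStabilizer h𝒢 M), ?_, k, ?_⟩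
    · exact Group.isSolvable_of_isSolvable_injective
        (f := (Subgroup.subgroupOfEquivOfLe hle').toMonoidHom)
        (Subgroup.subgroupOfEquivOfLe hle').injective
    · have h1 := Subgroup.card_mul_relIndex hle'
      rw [card_characteristicStabilizer h𝒢 hreg, card_characteristicStabilizer h𝒢 hreg, hcard,
        ← K.card_mul_index, hk] at h1
      exact Nat.eq_of_mul_eq_mul_left Nat.card_pos h1
  rcases Nat.exists_dvd_pow_mul_pow_or_three_primes (Nat.card_pos (α := M)).ne' with
    ⟨p, q, a, b, hp, hq, h⟩ | ⟨p, q, r, hp, hq, hr, hpq, hpr, hqr⟩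
  · refine Group.isSolvable_of_card_dvd_pow_mul_pow (a := a) (b := b) hp hq ?_
    rwa [card_characteristicStabilizer h𝒢 hreg]
  · obtain ⟨H₁, hs₁, a, h₁⟩ := hcompl p hp
    obtain ⟨H₂, hs₂, b, h₂⟩ := hcompl q hq
    obtain ⟨H₃, hs₃, c, h₃⟩ := hcompl r hr
    have hcop {p q : ℕ} (hp : p ∈ (Nat.card M).primeFactors) (hq : q ∈ (Nat.card M).primeFactors)
        (hpq : p ≠ q) (a b : ℕ) : (p ^ a).Coprime (q ^ b) :=
      Nat.Coprime.pow a b ((Nat.coprime_primes (Nat.prime_of_mem_primeFactors hp)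
        (Nat.prime_of_mem_primeFactors hq)).2 hpq)
    exact Group.isSolvable_of_coprime_index (H₁ := H₁) (H₂ := H₂) (H₃ := H₃)
      (by rw [h₁, h₂]; exact hcop hp hq hpq a b) (by rw [h₁, h₃]; exact hcop hp hr hpr a c)
      (by rw [h₂, h₃]; exact hcop hq hr hqr b c)

end Regular

theorem proposition6p1 {G N : Type*} [Group G] [Group N] [Finite G] [Finite N]
    (hcard : Nat.card G = Nat.card N) (hE : (regularSubgroupsOfHol G N).Nonempty) :
    {m : ℕ | ∃ M : Subgroup N, M.Characteristic ∧ Nat.card M = m} ⊆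
        {m : ℕ | ∃ H : Subgroup G, Nat.card H = m} ∧
      ∃ H : Subgroup G, Group.IsSolvable H ∧ Nat.card H = Nat.card (fittingSubgroup N) := by
  obtain ⟨𝒢, h𝒢, hreg, ⟨e⟩⟩ := hE
  have hmap (H : Subgroup 𝒢) : Nat.card (H.map e.toMonoidHom) = Nat.card H :=
    Nat.card_congr (H.equivMapOfInjective _ e.injective).symm.toEquiv
  refine ⟨?_, ?_⟩
  · rintro _ ⟨M, hM, rfl⟩
    exact ⟨(characteristicStabilizer h𝒢 M).map e.toMonoidHom, by
      rw [hmap, card_characteristicStabilizer h𝒢 hreg]⟩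
  · have := fittingSubgroup_characteristic (N := N)
    have := isNilpotent_fittingSubgroup (N := N)
    have := isSolvable_characteristicStabilizer h𝒢 hreg (fittingSubgroup N)
    refine ⟨(characteristicStabilizer h𝒢 (fittingSubgroup N)).map e.toMonoidHom, ?_, by
      rw [hmap, card_characteristicStabilizer h𝒢 hreg]⟩
    exact Group.isSolvable_of_surjective (e.toMonoidHom.subgroupMap_surjective _)
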